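/- Let $0\le k\le n$ and $r\ge 1$ be integers and $\hat T=[-1,1]^n$. For a finite ordered set $I$ of coordinates and $\sigma\subset I$ with elements $\sigma_1<\dots<\sigma_k$ put $dx_\sigma=dx_{\sigma_1}\wedge\dots\wedge dx_{\sigma_k}$. Consider differential $k$-forms $u=\sum_{|\sigma|=k}u_\sigma\,dx_\sigma$ with polynomial coefficients $u_\sigma\in\mathbb R[x_i: i\in I]$, with exterior derivative $d$ and Koszul operator $\kappa$ (contraction with the vector $x$). For $s\ge 0$ let $$\mathcal Q_s^-\Lambda^k=\operatorname{span}\{x^\alpha dx_\sigma:\ |\sigma|=k,\ \alpha_i\le s\ \text{for all } i,\ \alpha_i\ne s\ \text{for all } i\in\sigma\},$$ $$\mathcal B_s\Lambda^k=\operatorname{span}\{x^\alpha dx_\sigma:\ |\sigma|=k,\ \alpha_i\le s\ \text{for all } i,\ \alpha_i=s\ \text{for some } i\in\sigma\},$$ $$\tilde{\mathcal Q}_s\Lambda^k=\mathcal Q_s^-\Lambda^k+d\kappa\,\mathcal B_s\Lambda^k .$$ On $\hat T$ one takes $I=\{1,\dots,n\}$; on an $l$-dimensional face $f$ of $\hat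 T$ one takes for $I$ the $l$ coordinates that are not constant on $f$. Let $\operatorname{tr}_f$ be the pullback of forms to $f$. Theorem. There is a unique linear operator $\hat\Pi_h:\tilde{\mathcal Q}_r\Lambda^k(\hat T)\to\mathcal Q_r^-\Lambda^k(\hat T)$ such that, for every $u$, $\hat\Pi_h u$ is the only element of $\mathcal Q_r^-\Lambda^k(\hat T)$ with $$\int_f \operatorname{tr}_f u\wedge v=\int_f\operatorname{tr}_f\hat\Pi_h u\wedge v$$ for all $l$-dimensional faces $f$ of $\hat T$ with $k\le l\le n$ and all $v\in\mathcal Q_{r-1}^-\Lambda^{l-k}(f)$. Moreover, let $L_m$ be the Legendre polynomial of degree $m$ on $[-1,1]$ with $L_m(1)=1$, let $u\in\tilde{\mathcal Q}_r\Lambda^k(\hat T)$, and write $u-\hat\Pi_h u=\sum_{|\sigma|=k}v_\sigma\,dx_\sigma$. Then every $v_\sigma$ has the form $$v_\sigma=\sum_{i\notin\sigma}\bigl(L_{r+1}(x_i)-L_{r-1}(x_i)\bigr)p_{\sigma,i}+v_{\sigma,0},$$ where each $p_{\sigma,i}$ is a polynomial of degree at most $r$ in each $x_j$ with $j\notin\sigma$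 and at most $r-1$ in each $x_j$ with $j\in\sigma$, and every term in the expansion of the polynomial $v_{\sigma,0}$ in the tensor product Legendre polynomials $\prod_{i=1}^n L_{d_i}(x_i)$ has the factor $L_r(x_j)$ (that is, $d_j=r$) for some $j\in\sigma$. -/

import Mathlib

open MvPolynomial

noncomputable section

namespace CubicalForms

/-- Polynomial differential forms in the variables `x_i`, `i ∈ ι`: the form
`u = ∑_σ u_σ dx_σ` is given by its coefficients `u_σ`, where `σ ⊆ ι` is listed increasingly in
`dx_σ = dx_{σ_1} ∧ ⋯ ∧ dx_{σ_k}`. A `k`-form is one with `u_σ = 0` unless `|σ| = k`. -/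
abbrev PForm (ι : Type) : Type := Finset ι → MvPolynomial ι ℝ

variable {ι : Type} [Fintype ι] [LinearOrder ι]

/-- The sign `ε(σ, τ)` with `dx_σ ∧ dx_τ = ε(σ, τ) dx_{σ ∪ τ}` for disjoint `σ`, `τ`:
`(-1)` to the number of pairs `(i, j) ∈ σ × τ` with `j < i`. -/
def wedgeSign (σ τ : Finset ι) : ℝ :=
  (-1) ^ ((σ ×ˢ τ).filter fun q => q.2 < q.1).card

/-- The wedge product,
`u ∧ v = ∑_{σ ∩ τ = ∅} ε(σ, τ) u_σ v_τ dx_{σ ∪ τ}`. -/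
def wedge (u v : PForm ι) : PForm ι := fun ρ =>
  ∑ σ ∈ ρ.powerset, wedgeSign σ (ρ \ σ) • (u σ * v (ρ \ σ))

/-- The exterior derivative `d u = ∑_σ ∑_i ∂_i u_σ dx_i ∧ dx_σ`. -/
def extD : PForm ι →ₗ[ℝ] PForm ι where
  toFun u := fun ρ => ∑ i ∈ ρ, wedgeSign {i} (ρ.erase i) • pderiv i (u (ρ.erase i))
  map_add' u v := by
    funext ρ
    simp only [Pi.add_apply, map_add, smul_add, Finset.sum_add_distrib]
  map_smul' c u := by
    funext ρ
    simp only [Pi.smul_apply, Derivation.map_smul, RingHom.id_apply, Finset.smul_sum]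
    exact Finset.sum_congr rfl fun i _ => smul_comm _ _ _

/-- The Koszul operator, contraction with the vector `x`: it is linear over polynomials and
`κ dx_σ = ∑_{i ∈ σ} ε(i, σ - i) x_i dx_{σ - i}`; hence
`(κ u)_τ = ∑_{i ∉ τ} ε(i, τ) x_i u_{τ + i}`. -/
def koszul : PForm ι →ₗ[ℝ] PForm ι where
  toFun u := fun τ => ∑ i ∈ τᶜ, wedgeSign {i} τ • (X i * u (insert i τ))
  map_add' u v := by
    funext τ
    simp only [Pi.add_apply, mul_add, smul_add, Finset.sum_add_distrib]
  map_smul' c u := by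
    funext τ
    simp only [Pi.smul_apply, mul_smul_comm, RingHom.id_apply, Finset.smul_sum]
    exact Finset.sum_congr rfl fun i _ => smul_comm _ _ _

/-- The form monomial `x^α dx_σ`. -/
def formMonomial (α : ι →₀ ℕ) (σ : Finset ι) : PForm ι :=
  Pi.single σ (monomial α 1)

/-- The conforming `s`-degree of `x^α dx_σ`: the number of `i ∈ σ` with `α_i = s`. -/
def cdeg (s : ℕ) (α : ι →₀ ℕ) (σ : Finset ι) : ℕ :=
  (σ.filter fun i => α i = s).card

variable (ι) in
/-- `Q_r^- Λ^k`, spanned by the form monomials of degree at most `r` in each variable whose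
conforming `r`-degree is zero. -/
def Qminus (r k : ℕ) : Submodule ℝ (PForm ι) :=
  Submodule.span ℝ {m | ∃ (α : ι →₀ ℕ) (σ : Finset ι), σ.card = k ∧ (∀ i, α i ≤ r) ∧
    cdeg r α σ = 0 ∧ m = formMonomial α σ}

variable (ι) in
/-- `B_r Λ^k`, spanned by the form monomials of degree at most `r` in each variable whose
conforming `r`-degree is positive. -/
def Bspace (r k : ℕ) : Submodule ℝ (PForm ι) :=
  Submodule.span ℝ {m | ∃ (α : ι →₀ ℕ) (σ : Finset ι), σ.card = k ∧ (∀ i, α i ≤ r) ∧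
    0 < cdeg r α σ ∧ m = formMonomial α σ}

variable (ι) in
/-- The shape function space `Q̃_r Λ^k = Q_r^- Λ^k + d κ B_r Λ^k`. -/
def Qtilde (r k : ℕ) : Submodule ℝ (PForm ι) :=
  Qminus ι r k ⊔ (Bspace ι r k).map (extD ∘ₗ koszul)

/-- The integral of a top-degree form `w` over `[-1, 1]^ι`. -/
def cubeIntegral (w : PForm ι) : ℝ :=
  ∫ x in Set.Icc (-1 : ι → ℝ) 1, eval x (w Finset.univ)

/-- A face of `[-1, 1]^n` is encoded by `s : Fin n → {-1, 0, 1}`: it is the set of the points with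
`x_i = s i` where `s i = ±1`, the coordinates with `s i = 0` being free. `Free s` is the set of its
free coordinates (in increasing order), and its dimension is their number. -/
abbrev Free {n : ℕ} (s : Fin n → SignType) : Type := {i : Fin n // s i = 0}

/-- The dimension of a face. -/
abbrev faceDim {n : ℕ} (s : Fin n → SignType) : ℕ := Fintype.card (Free s)

/-- The trace (pullback) of a polynomial form to the face `s`, as a form in the free variables:
`x_i` becomes the constant `s i` and `dx_i` becomes zero for each fixed coordinate `i`. -/
def trace {n : ℕ} (s : Fin n → SignType) (u : PForm (Fin n)) : PForm (Free s) := fun τ =>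
  aeval (fun i : Fin n =>
      if h : s i = 0 then (X (⟨i, h⟩ : Free s) : MvPolynomial (Free s) ℝ)
      else C ((s i : SignType) : ℝ))
    (u (τ.map (Function.Embedding.subtype fun i : Fin n => s i = 0)))

/-- `w` has the same canonical degrees of freedom of `Q_r^- Λ^k` as `u`:
`∫_f tr_f u ∧ v = ∫_f tr_f w ∧ v` for all `v ∈ Q_{r-1}^- Λ^{l-k}(f)`, all `l`-dimensional faces
`f` of `[-1, 1]^n` and all `l ≥ k`. -/
def SameMoments {n : ℕ} (r k : ℕ) (u w : PForm (Fin n)) : Prop :=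
  ∀ s : Fin n → SignType, k ≤ faceDim s → ∀ v ∈ Qminus (Free s) (r - 1) (faceDim s - k),
    cubeIntegral (wedge (trace s u) v) = cubeIntegral (wedge (trace s w) v)

/-- The Legendre polynomial `L_m` on `[-1, 1]`, normalized by `L_m(1) = 1` (Rodrigues' formula). -/
def legendre (m : ℕ) : Polynomial ℝ :=
  Polynomial.C ((2 ^ m * m.factorial : ℝ)⁻¹) *
    (Polynomial.derivative^[m] ((Polynomial.X ^ 2 - 1) ^ m))

/-- `L_m(x_i)` as a polynomial in several variables. -/
def legendreAt (m : ℕ) (i : ι) : MvPolynomial ι ℝ :=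
  Polynomial.aeval (X i : MvPolynomial ι ℝ) (legendre m)

/-- `Q_{σ*,r} ⊗ Q_{σ,r-1}`: the polynomials of degree at most `r` in each `x_i` with `i ∉ σ` and at
most `r - 1` in each `x_j` with `j ∈ σ`. -/
def coefficientSpace (r : ℕ) (σ : Finset ι) : Submodule ℝ (MvPolynomial ι ℝ) :=
  restrictSupport ℝ {α : ι →₀ ℕ | (∀ i ∉ σ, α i ≤ r) ∧ ∀ j ∈ σ, α j ≤ r - 1}

/-- The polynomials all of whose terms, in the expansion in the basis of the tensor product
Legendre polynomials `∏_i L_{d_i}(x_i)`, contain the factor `L_r(x_j)` for some `j ∈ σ`. -/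
def conformingLegendreSpan (r : ℕ) (σ : Finset ι) : Submodule ℝ (MvPolynomial ι ℝ) :=
  Submodule.span ℝ {q | ∃ d : ι → ℕ, (∃ j ∈ σ, d j = r) ∧ q = ∏ i, legendreAt (d i) i}

end CubicalForms

end

/-! Everything splits over the coefficients `u_σ` and then over the variables. A test monomial on a
face sees one coefficient only, and its moment is a tensor product of one-variable functionals:
moments of order `< r` in `x_i` for `i ∈ σ`; endpoint values and moments of order `< r - 1` for `i ∉
σ` (`faceMoment_tensor`, `sameMoments_iff`). These functionals are unisolvent on degree `< r` and
degree `≤ r` respectively, so the operator is a tensor product of one-variable projections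
(`project_tensor`), and `Q_r^-` consists exactly of the forms whose coefficients lie in the ranges
(`mem_Qminus`).

For the error, the inner projection annihilates `L_r` and the outer one annihilates `L_{r+1} -
L_{r-1}`. A term of `dκ(x^α dx_τ)` in the coefficient of `dx_σ` has degree at most `r` in every
variable, except possibly `r + 1` in a single `x_i` with `i ∉ σ` (`extD_koszul_formMonomial_mem`).
Projecting such a monomial one variable at a time, each variable in `σ` leaves a term with the
factor `L_r`, and only that `x_i` leaves a multiple of `L_{r+1} - L_{r-1}`. -/

noncomputable section

namespace CubicalForms

/-! ### Integration of polynomials on `[-1, 1]` -/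

/-- The integral of a polynomial over `[-1, 1]`. -/
def polyIntegral : Polynomial ℝ →ₗ[ℝ] ℝ where
  toFun p := ∫ x in Set.Icc (-1 : ℝ) 1, p.eval x
  map_add' p q := by
    simp only [Polynomial.eval_add]
    exact MeasureTheory.integral_add
      (p.continuous.continuousOn.integrableOn_compact isCompact_Icc)
      (q.continuous.continuousOn.integrableOn_compact isCompact_Icc)
  map_smul' c p := by
    simp only [Polynomial.eval_smul, RingHom.id_apply]
    exact MeasureTheory.integral_smul c _

theorem polyIntegral_eq_intervalIntegral (p : Polynomial ℝ) :
    polyIntegral p = ∫ x in (-1 : ℝ)..1, p.eval x := by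
  rw [intervalIntegral.integral_of_le (by norm_num), ← MeasureTheory.integral_Icc_eq_integral_Ioc]
  rfl

theorem polyIntegral_derivative (p : Polynomial ℝ) :
    polyIntegral (Polynomial.derivative p) = p.eval 1 - p.eval (-1) := by
  rw [polyIntegral_eq_intervalIntegral]
  exact intervalIntegral.integral_eq_sub_of_hasDerivAt (fun x _ => p.hasDerivAt x)
    ((Polynomial.derivative p).continuous.intervalIntegrable _ _)

/-- Drives both unisolvence proofs, applied to `p²` and to `(1 - x²) q²`. -/
theorem eq_zero_of_polyIntegral_eq_zero {p : Polynomial ℝ}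
    (hp : ∀ x ∈ Set.Icc (-1 : ℝ) 1, 0 ≤ p.eval x) (h : polyIntegral p = 0) : p = 0 := by
  by_contra hne
  obtain ⟨c, hc, hc0⟩ : ∃ c ∈ Set.Icc (-1 : ℝ) 1, p.eval c ≠ 0 := by
    by_contra! hall
    exact hne (p.eq_zero_of_infinite_isRoot
      ((Set.Icc_infinite (by norm_num : (-1 : ℝ) < 1)).mono hall))
  have := intervalIntegral.integral_pos (by norm_num : (-1 : ℝ) < 1) p.continuous.continuousOn
    (fun x hx => hp x (Set.Ioc_subset_Icc_self hx)) ⟨c, hc, lt_of_le_of_ne (hp c hc) hc0.symm⟩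
  rw [← polyIntegral_eq_intervalIntegral, h] at this
  exact this.false

theorem polyIntegral_mul_eq_zero {N : ℕ} {p q : Polynomial ℝ}
    (h : ∀ b < N, polyIntegral (p * Polynomial.X ^ b) = 0) (hq : q ∈ Polynomial.degreeLT ℝ N) :
    polyIntegral (p * q) = 0 := by
  classical
  rw [Polynomial.degreeLT_eq_span_X_pow] at hq
  induction hq using Submodule.span_induction with
  | mem x hx =>
    simp only [Finset.coe_image, Set.mem_image, Finset.mem_coe, Finset.mem_range] at hx
    obtain ⟨b, hb, rfl⟩ := hx
    exact h b hb
  | zero => simp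
  | add x y _ _ hx hy => rw [mul_add, map_add, hx, hy, add_zero]
  | smul c x _ hx => rw [mul_smul_comm, map_smul, hx, smul_zero]

/-! ### Legendre polynomials: orthogonality, degree, endpoint values -/

/-- Repeated integration by parts against a polynomial with zeros of high order at `±1`. -/
theorem polyIntegral_iterate_derivative_mul (m : ℕ) (g q : Polynomial ℝ)
    (hg : (Polynomial.X ^ 2 - 1) ^ m ∣ g) :
    polyIntegral (Polynomial.derivative^[m] g * q) =
      (-1) ^ m * polyIntegral (g * Polynomial.derivative^[m] q) := by
  induction m generalizing q with
  | zero => simp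
  | succ m ih =>
    -- After `m` derivatives one factor `X² - 1` survives, which kills the boundary terms.
    have hdvd := Polynomial.pow_sub_dvd_iterate_derivative_of_pow_dvd m hg
    rw [Nat.add_sub_cancel_left, pow_one] at hdvd
    obtain ⟨t, ht⟩ := hdvd
    have key := polyIntegral_derivative (Polynomial.derivative^[m] g * q)
    rw [Polynomial.derivative_mul, map_add] at key
    rw [Function.iterate_succ_apply', Function.iterate_succ_apply, pow_succ,
      eq_neg_of_add_eq_zero_left (key.trans (by simp [ht])),
      ih _ ((pow_dvd_pow _ (Nat.le_succ m)).trans hg)]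
    ring

/-- By Rodrigues' formula all `m` derivatives move onto `q`, whose degree is below `m`. -/
theorem polyIntegral_legendre_mul {m : ℕ} {q : Polynomial ℝ} (hq : q ∈ Polynomial.degreeLT ℝ m) :
    polyIntegral (legendre m * q) = 0 := by
  have h0 : Polynomial.derivative^[m] q = 0 :=
    Polynomial.iterate_derivative_eq_zero_of_degree_lt (Polynomial.mem_degreeLT.1 hq)
  rw [legendre, mul_assoc, Polynomial.C_mul', map_smul,
    polyIntegral_iterate_derivative_mul m _ _ dvd_rfl, h0]
  simp

theorem degree_legendre (m : ℕ) : (legendre m).degree = m := by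
  have hmon : ((Polynomial.X ^ 2 - 1 : Polynomial ℝ) ^ m).Monic :=
    (Polynomial.monic_X_pow_sub_C (1 : ℝ) two_ne_zero).pow m
  have hdeg : ((Polynomial.X ^ 2 - 1 : Polynomial ℝ) ^ m).natDegree = m + m := by
    rw [Polynomial.natDegree_pow]
    have : (Polynomial.X ^ 2 - 1 : Polynomial ℝ).natDegree = 2 :=
      Polynomial.natDegree_X_pow_sub_C (n := 2) (r := (1 : ℝ))
    rw [this]; ring
  have hc : (2 ^ m * m.factorial : ℝ)⁻¹ ≠ 0 := by positivity
  rw [legendre, Polynomial.degree_C_mul hc]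
  refine Polynomial.degree_eq_of_le_of_coeff_ne_zero ?_ ?_
  · refine Polynomial.degree_le_of_natDegree_le
      ((Polynomial.natDegree_iterate_derivative _ _).trans ?_)
    rw [hdeg]; omega
  · rw [Polynomial.coeff_iterate_derivative, ← hdeg, hmon.coeff_natDegree, hdeg]
    simp

theorem legendre_mem_degreeLT {m N : ℕ} (h : m < N) : legendre m ∈ Polynomial.degreeLT ℝ N := by
  rw [Polynomial.mem_degreeLT, degree_legendre]
  exact_mod_cast h

theorem eval_iterate_derivative (m : ℕ) (x : ℝ) (p : Polynomial ℝ) :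
    (Polynomial.derivative^[m] p).eval x = m.factorial * (Polynomial.taylor x p).coeff m := by
  rw [Polynomial.taylor_coeff, ← Polynomial.factorial_smul_hasseDeriv]
  simp

/-- With `y = x - 1`, `(x² - 1)^m = y^m (y + 2)^m`, whose coefficient of `y^m` is `2^m`; the factor
`2^m m!` is exactly the normalization. -/
theorem eval_legendre_one (m : ℕ) : (legendre m).eval 1 = 1 := by
  have h : Polynomial.taylor (1 : ℝ) ((Polynomial.X ^ 2 - 1) ^ m) =
      Polynomial.X ^ m * (Polynomial.X + Polynomial.C 2) ^ m := by
    rw [← mul_pow, Polynomial.taylor_pow]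
    congr 1
    simp only [map_sub, Polynomial.taylor_pow, Polynomial.taylor_X, Polynomial.taylor_one,
      Polynomial.C_1, Polynomial.C_ofNat]
    ring
  rw [legendre, Polynomial.eval_mul, Polynomial.eval_C, eval_iterate_derivative, h,
    Polynomial.coeff_X_pow_mul', if_pos le_rfl, Nat.sub_self, Polynomial.coeff_zero_eq_eval_zero]
  have : (m.factorial : ℝ) ≠ 0 := by positivity
  simp
  field_simp

theorem eval_legendre_neg_one (m : ℕ) : (legendre m).eval (-1) = (-1) ^ m := by
  have h : Polynomial.taylor (-1 : ℝ) ((Polynomial.X ^ 2 - 1) ^ m) =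
      Polynomial.X ^ m * (Polynomial.X - Polynomial.C 2) ^ m := by
    rw [← mul_pow, Polynomial.taylor_pow]
    congr 1
    simp only [map_sub, Polynomial.taylor_pow, Polynomial.taylor_X, Polynomial.taylor_one,
      Polynomial.C_neg, Polynomial.C_1, Polynomial.C_ofNat]
    ring
  rw [legendre, Polynomial.eval_mul, Polynomial.eval_C, eval_iterate_derivative, h,
    Polynomial.coeff_X_pow_mul', if_pos le_rfl, Nat.sub_self, Polynomial.coeff_zero_eq_eval_zero]
  have : (m.factorial : ℝ) ≠ 0 := by positivity
  simp
  rw [show (-2 : ℝ) = -1 * 2 by norm_num, mul_pow]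
  field_simp

theorem exists_sub_legendre_mem {r : ℕ} {p : Polynomial ℝ}
    (hp : p ∈ Polynomial.degreeLT ℝ (r + 1)) :
    ∃ c : ℝ, p - c • legendre r ∈ Polynomial.degreeLT ℝ r := by
  have hl : (legendre r).coeff r ≠ 0 := by
    have := degree_legendre r
    have h2 : (legendre r).natDegree = r := Polynomial.natDegree_eq_of_degree_eq_some this
    have h3 : legendre r ≠ 0 := by
      rintro h; rw [h] at this; simp at this
    nth_rewrite 2 [← h2]
    exact Polynomial.leadingCoeff_ne_zero.2 h3
  refine ⟨p.coeff r / (legendre r).coeff r, ?_⟩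
  have h1 : p - (p.coeff r / (legendre r).coeff r) • legendre r ∈ Polynomial.degreeLT ℝ (r + 1) :=
    Submodule.sub_mem _ hp (Submodule.smul_mem _ _ (legendre_mem_degreeLT r.lt_succ_self))
  rw [Polynomial.mem_degreeLT, Polynomial.degree_lt_iff_coeff_zero] at h1 ⊢
  intro m hm
  rcases hm.eq_or_lt with rfl | hm
  · simp [hl]
  · exact h1 m hm

theorem span_range_legendre : Submodule.span ℝ (Set.range legendre) = ⊤ := by
  refine Polynomial.Sequence.span ⟨legendre, degree_legendre⟩ fun i => ?_
  rw [isUnit_iff_ne_zero, Polynomial.leadingCoeff_ne_zero]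
  intro h
  have := degree_legendre i
  rw [show legendre i = 0 from h] at this
  simp at this

/-! ### One-variable degrees of freedom and their unisolvence -/

/-- A degree of freedom in one variable: a moment of order `a.2` if `a.1 = 0`, and the value at the
endpoint `a.1` otherwise. -/
def dof (a : SignType × ℕ) : Polynomial ℝ →ₗ[ℝ] ℝ :=
  if a.1 = 0 then polyIntegral ∘ₗ LinearMap.mulRight ℝ (Polynomial.X ^ a.2)
  else Polynomial.leval ((a.1 : SignType) : ℝ)

theorem dof_zero (b : ℕ) (p : Polynomial ℝ) :
    dof (0, b) p = polyIntegral (p * Polynomial.X ^ b) := by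
  simp [dof]

theorem dof_of_ne {a : SignType × ℕ} (ha : a.1 ≠ 0) (p : Polynomial ℝ) :
    dof a p = p.eval ((a.1 : SignType) : ℝ) := by
  simp [dof, ha, Polynomial.leval]

/-- The family `e` of polynomials of degree less than `|A|` is dual to the degrees of freedom in
`A`. -/
def IsDualFamily (A : Finset (SignType × ℕ)) (e : SignType × ℕ → Polynomial ℝ) : Prop :=
  (∀ a ∈ A, e a ∈ Polynomial.degreeLT ℝ A.card) ∧
  (∀ a ∈ A, ∀ b ∈ A, dof b (e a) = if a = b then 1 else 0) ∧
  ∀ p ∈ Polynomial.degreeLT ℝ A.card, ∑ a ∈ A, dof a p • e a = p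

/-- The degrees of freedom in `A` determine the polynomials of degree less than `|A|`. -/
def Unisolvent (A : Finset (SignType × ℕ)) : Prop :=
  ∀ p ∈ Polynomial.degreeLT ℝ A.card, (∀ a ∈ A, dof a p = 0) → p = 0

/-- Evaluating the functionals is an injection between spaces of dimension `|A|`, hence a bijection;
the dual family consists of the preimages of the unit vectors. -/
theorem Unisolvent.exists_dual {A : Finset (SignType × ℕ)} (h : Unisolvent A) :
    ∃ e, IsDualFamily A e := by
  classical
  let V := Polynomial.degreeLT ℝ A.card
  let Φ : V →ₗ[ℝ] (A → ℝ) := LinearMap.pi fun a => dof a.1 ∘ₗ V.subtype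
  have hinj : Function.Injective Φ := by
    rw [← LinearMap.ker_eq_bot, LinearMap.ker_eq_bot']
    intro p hp
    exact Subtype.ext (h p p.2 fun a ha => congrFun hp ⟨a, ha⟩)
  have : Module.Finite ℝ V := Module.Finite.equiv (Polynomial.degreeLTEquiv ℝ A.card).symm
  have hdim : Module.finrank ℝ V = Module.finrank ℝ (A → ℝ) := by
    rw [(Polynomial.degreeLTEquiv ℝ A.card).finrank_eq]; simp
  let Ψ := LinearMap.linearEquivOfInjective Φ hinj hdim
  have hΨ : ∀ (p : V) (a : A), Ψ p a = dof a.1 p.1 := fun p a => rfl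
  let e : SignType × ℕ → Polynomial ℝ := fun a =>
    if ha : a ∈ A then (Ψ.symm (Pi.single ⟨a, ha⟩ 1)).1 else 0
  have he : ∀ a ∈ A, e a ∈ Polynomial.degreeLT ℝ A.card := fun a ha => by
    simp only [e, dif_pos ha]; exact (Ψ.symm _).2
  have hd : ∀ a ∈ A, ∀ b ∈ A, dof b (e a) = if a = b then 1 else 0 := fun a ha b hb => by
    simp only [e, dif_pos ha]
    rw [← hΨ _ ⟨b, hb⟩, LinearEquiv.apply_symm_apply, Pi.single_apply]
    simp [eq_comm]
  refine ⟨e, he, hd, fun p hp => ?_⟩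
  rw [← sub_eq_zero]
  refine h _ (Submodule.sub_mem _ (Submodule.sum_mem _ fun a ha =>
    Submodule.smul_mem _ _ (he a ha)) hp) fun b hb => ?_
  rw [map_sub, map_sum, sub_eq_zero]
  simp only [map_smul, smul_eq_mul]
  rw [Finset.sum_congr rfl fun a ha => by rw [hd a ha b hb]]
  simp [hb]

/-- Moments of order less than `r`. -/
def innerDofs (r : ℕ) : Finset (SignType × ℕ) := {0} ×ˢ Finset.range r

/-- Moments of order less than `r - 1` and endpoint values. -/
def outerDofs (r : ℕ) : Finset (SignType × ℕ) :=
  {0} ×ˢ Finset.range (r - 1) ∪ {1, -1} ×ˢ {0}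

theorem mem_innerDofs {r : ℕ} {a : SignType × ℕ} : a ∈ innerDofs r ↔ a.1 = 0 ∧ a.2 < r := by
  obtain ⟨s, b⟩ := a
  simp only [innerDofs, Finset.mem_product, Finset.mem_singleton, Finset.mem_range]

theorem mem_outerDofs {r : ℕ} {a : SignType × ℕ} :
    a ∈ outerDofs r ↔ a.1 = 0 ∧ a.2 < r - 1 ∨ a.1 ≠ 0 ∧ a.2 = 0 := by
  obtain ⟨s, b⟩ := a
  cases s <;> simp [outerDofs]

theorem card_innerDofs (r : ℕ) : (innerDofs r).card = r := by
  simp [innerDofs]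

theorem card_outerDofs {r : ℕ} (hr : 1 ≤ r) : (outerDofs r).card = r + 1 := by
  rw [outerDofs, Finset.card_union_of_disjoint]
  · simp only [Finset.card_product, Finset.card_singleton, Finset.card_range]
    rw [show ({1, -1} : Finset SignType).card = 2 from rfl]
    omega
  · rw [Finset.disjoint_left]
    rintro ⟨s, b⟩ h1 h2
    simp only [Finset.mem_product, Finset.mem_singleton, Finset.mem_insert] at h1 h2
    rw [h1.1] at h2
    exact absurd h2.1 (by decide)

/-- The vanishing moments make `p` orthogonal to itself. -/
theorem unisolvent_innerDofs (r : ℕ) : Unisolvent (innerDofs r) := by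
  intro p hp h
  rw [card_innerDofs] at hp
  have h2 := polyIntegral_mul_eq_zero (N := r) (p := p) (q := p)
    (fun b hb => by simpa [dof_zero] using h (0, b) (mem_innerDofs.2 ⟨rfl, hb⟩)) hp
  exact mul_self_eq_zero.1 (eq_zero_of_polyIntegral_eq_zero
    (fun x _ => by rw [Polynomial.eval_mul]; exact mul_self_nonneg _) h2)

theorem exists_eq_mul_of_eval_eq_zero {r : ℕ} {p : Polynomial ℝ}
    (hp : p ∈ Polynomial.degreeLT ℝ (r + 1)) (h1 : p.eval 1 = 0) (h2 : p.eval (-1) = 0) :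
    ∃ q ∈ Polynomial.degreeLT ℝ (r - 1), p = (Polynomial.X ^ 2 - 1) * q := by
  have hd : (Polynomial.X - Polynomial.C (1 : ℝ)) * (Polynomial.X - Polynomial.C (-1)) ∣ p :=
    (Polynomial.isCoprime_X_sub_C_of_isUnit_sub (by norm_num)).mul_dvd
      (Polynomial.dvd_iff_isRoot.2 h1) (Polynomial.dvd_iff_isRoot.2 h2)
  rw [show (Polynomial.X - Polynomial.C (1 : ℝ)) * (Polynomial.X - Polynomial.C (-1)) =
    Polynomial.X ^ 2 - 1 by simp; ring] at hd
  obtain ⟨q, rfl⟩ := hd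
  refine ⟨q, ?_, rfl⟩
  rcases eq_or_ne q 0 with rfl | hq
  · exact Submodule.zero_mem _
  rw [Polynomial.mem_degreeLT, Polynomial.degree_mul,
    show (Polynomial.X ^ 2 - 1 : Polynomial ℝ).degree = 2 from
      Polynomial.degree_X_pow_sub_C two_pos (1 : ℝ), Polynomial.degree_eq_natDegree hq] at hp
  rw [Polynomial.mem_degreeLT, Polynomial.degree_eq_natDegree hq]
  have : 2 + q.natDegree < r + 1 := by exact_mod_cast hp
  exact_mod_cast (by omega : q.natDegree < r - 1)

/-- The endpoint values give `p = (x² - 1) q` with `deg q < r - 1`, and the moments then make `∫ (1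
- x²) q²` vanish. For `r = 1` the quotient `q` is already zero. -/
theorem unisolvent_outerDofs {r : ℕ} (hr : 1 ≤ r) : Unisolvent (outerDofs r) := by
  intro p hp h
  rw [card_outerDofs hr] at hp
  have h1 : p.eval 1 = 0 := by
    simpa [dof_of_ne] using h (1, 0) (mem_outerDofs.2 (Or.inr ⟨by decide, rfl⟩))
  have h2 : p.eval (-1) = 0 := by
    simpa [dof_of_ne] using h (-1, 0) (mem_outerDofs.2 (Or.inr ⟨by decide, rfl⟩))
  obtain ⟨q, hq, rfl⟩ := exists_eq_mul_of_eval_eq_zero hp h1 h2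
  have h3 := polyIntegral_mul_eq_zero (N := r - 1) (q := q)
    (fun b hb => by simpa [dof_zero] using h (0, b) (mem_outerDofs.2 (Or.inl ⟨rfl, hb⟩))) hq
  have h4 : -((Polynomial.X ^ 2 - 1) * q * q) = 0 := by
    refine eq_zero_of_polyIntegral_eq_zero (fun x hx => ?_) (by rw [map_neg, h3, neg_zero])
    have : x ^ 2 ≤ 1 := by nlinarith [hx.1, hx.2]
    simp only [Polynomial.eval_neg, Polynomial.eval_mul, Polynomial.eval_sub, Polynomial.eval_pow,
      Polynomial.eval_X, Polynomial.eval_one]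
    nlinarith [mul_nonneg (sub_nonneg.2 this) (mul_self_nonneg (q.eval x))]
  rw [neg_eq_zero, mul_eq_zero] at h4
  rcases h4 with h4 | h4
  · exact h4
  · rw [h4, mul_zero]

/-! ### One-variable projections and their errors -/

/-- The dual family of a unisolvent set of degrees of freedom. -/
def dualFamily (A : Finset (SignType × ℕ)) : SignType × ℕ → Polynomial ℝ :=
  Classical.epsilon (IsDualFamily A)

theorem Unisolvent.isDualFamily {A : Finset (SignType × ℕ)} (h : Unisolvent A) :
    IsDualFamily A (dualFamily A) :=
  Classical.epsilon_spec h.exists_dual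

/-- The projection in one variable with the degrees of freedom in `A`. -/
def interp (A : Finset (SignType × ℕ)) (p : Polynomial ℝ) : Polynomial ℝ :=
  ∑ a ∈ A, dof a p • dualFamily A a

theorem interp_sub_smul (A : Finset (SignType × ℕ)) (p q : Polynomial ℝ) (c : ℝ) :
    interp A (p - c • q) = interp A p - c • interp A q := by
  simp only [interp, map_sub, map_smul, sub_smul, Finset.sum_sub_distrib, Finset.smul_sum,
    smul_assoc]

theorem interp_eq_zero {A : Finset (SignType × ℕ)} {p : Polynomial ℝ}
    (h : ∀ a ∈ A, dof a p = 0) : interp A p = 0 :=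
  Finset.sum_eq_zero fun a ha => by rw [h a ha, zero_smul]

theorem interp_innerDofs_legendre (r : ℕ) : interp (innerDofs r) (legendre r) = 0 := by
  refine interp_eq_zero fun a ha => ?_
  obtain ⟨s, b⟩ := a
  obtain ⟨rfl, hb⟩ := mem_innerDofs.1 ha
  rw [dof_zero]
  refine polyIntegral_legendre_mul (Polynomial.mem_degreeLT.2 ?_)
  rw [Polynomial.degree_X_pow]
  exact_mod_cast hb

/-- Both Legendre polynomials are orthogonal to degree `< r - 1`, and they agree at `±1` because
their indices have the same parity. -/
theorem interp_outerDofs_legendre_sub {r : ℕ} (hr : 1 ≤ r) :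
    interp (outerDofs r) (legendre (r + 1) - legendre (r - 1)) = 0 := by
  refine interp_eq_zero fun a ha => ?_
  obtain ⟨s, b⟩ := a
  obtain ⟨rfl, hb⟩ | ⟨hs, -⟩ := mem_outerDofs.1 ha
  · have hX : (Polynomial.X ^ b : Polynomial ℝ) ∈ Polynomial.degreeLT ℝ (r - 1) := by
      rw [Polynomial.mem_degreeLT, Polynomial.degree_X_pow]
      exact_mod_cast hb
    rw [dof_zero, sub_mul, map_sub, polyIntegral_legendre_mul hX,
      polyIntegral_legendre_mul (Polynomial.degreeLT_mono (by omega) hX), sub_zero]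
  · rw [dof_of_ne hs, Polynomial.eval_sub]
    obtain ⟨m, rfl⟩ := Nat.exists_eq_add_of_le' hr
    cases s
    · exact absurd rfl hs
    · simp [eval_legendre_neg_one, pow_succ]
    · simp [eval_legendre_one]

theorem interp_innerDofs_eq_self {r : ℕ} {p : Polynomial ℝ} (hp : p ∈ Polynomial.degreeLT ℝ r) :
    interp (innerDofs r) p = p :=
  (unisolvent_innerDofs r).isDualFamily.2.2 p (by rwa [card_innerDofs])

theorem interp_outerDofs_eq_self {r : ℕ} (hr : 1 ≤ r) {p : Polynomial ℝ}
    (hp : p ∈ Polynomial.degreeLT ℝ (r + 1)) : interp (outerDofs r) p = p :=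
  (unisolvent_outerDofs hr).isDualFamily.2.2 p (by rwa [card_outerDofs hr])

/-- Subtracting a multiple of the annihilated `L_r` brings `p` into the range, where the projection
is the identity. -/
theorem exists_sub_interp_innerDofs {r : ℕ} {p : Polynomial ℝ}
    (hp : p ∈ Polynomial.degreeLT ℝ (r + 1)) :
    ∃ c : ℝ, p - interp (innerDofs r) p = c • legendre r := by
  obtain ⟨c, hc⟩ := exists_sub_legendre_mem hp
  refine ⟨c, ?_⟩
  have h := interp_innerDofs_eq_self hc
  rw [interp_sub_smul, interp_innerDofs_legendre, smul_zero, sub_zero] at h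
  rw [h, sub_sub_cancel]

theorem exists_sub_interp_outerDofs {r : ℕ} (hr : 1 ≤ r) {p : Polynomial ℝ}
    (hp : p ∈ Polynomial.degreeLT ℝ (r + 2)) :
    ∃ c : ℝ, p - interp (outerDofs r) p = c • (legendre (r + 1) - legendre (r - 1)) := by
  obtain ⟨c, hc⟩ := exists_sub_legendre_mem hp
  refine ⟨c, ?_⟩
  -- The `L_{r-1}` put back has degree at most `r`, so the leading term still cancels.
  have hc' : p - c • (legendre (r + 1) - legendre (r - 1)) ∈ Polynomial.degreeLT ℝ (r + 1) := by
    rw [smul_sub, sub_sub_eq_add_sub, add_sub_right_comm]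
    exact Submodule.add_mem _ hc (Submodule.smul_mem _ _ (legendre_mem_degreeLT (by omega)))
  have h := interp_outerDofs_eq_self hr hc'
  rw [interp_sub_smul, interp_outerDofs_legendre_sub hr, smul_zero, sub_zero] at h
  rw [h, sub_sub_cancel]


/-! ### Tensor products of one-variable polynomials -/

section Tensor

variable {ι : Type} [Fintype ι]

/-- The tensor product `∏ i, p_i(x_i)` of polynomials in one variable. -/
def tensor (p : ι → Polynomial ℝ) : MvPolynomial ι ℝ := ∏ i, Polynomial.aeval (X i) (p i)

theorem tensor_eq_mul [DecidableEq ι] (p : ι → Polynomial ℝ) (i : ι) :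
    tensor p = Polynomial.aeval (X i) (p i) *
      ∏ j ∈ Finset.univ.erase i, Polynomial.aeval (X j : MvPolynomial ι ℝ) (p j) :=
  (Finset.mul_prod_erase _ _ (Finset.mem_univ i)).symm

theorem tensor_update [DecidableEq ι] (p : ι → Polynomial ℝ) (i : ι) (q : Polynomial ℝ) :
    tensor (Function.update p i q) = Polynomial.aeval (X i) q *
      ∏ j ∈ Finset.univ.erase i, Polynomial.aeval (X j : MvPolynomial ι ℝ) (p j) := by
  rw [tensor_eq_mul _ i, Function.update_self]
  congr 1
  refine Finset.prod_congr rfl fun j hj => ?_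
  rw [Function.update_of_ne (Finset.ne_of_mem_erase hj)]

theorem tensor_sub [DecidableEq ι] {p q : ι → Polynomial ℝ} (i : ι) (h : ∀ j ≠ i, p j = q j) :
    tensor p - tensor q = tensor (Function.update p i (p i - q i)) := by
  rw [tensor_update, tensor_eq_mul p i, tensor_eq_mul q i, map_sub, sub_mul]
  congr 2
  exact Finset.prod_congr rfl fun j hj => by rw [h j (Finset.ne_of_mem_erase hj)]

theorem tensor_mul (p q : ι → Polynomial ℝ) : tensor p * tensor q = tensor (p * q) := by
  simp [tensor, Finset.prod_mul_distrib]

theorem monomial_eq_tensor (α : ι →₀ ℕ) :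
    (monomial α 1 : MvPolynomial ι ℝ) = tensor fun i => Polynomial.X ^ α i := by
  rw [monomial_eq, Finsupp.prod_fintype _ _ fun i => pow_zero _]
  simp [tensor]

theorem linearMap_ext_tensor {M : Type*} [AddCommGroup M] [Module ℝ M]
    {f g : MvPolynomial ι ℝ →ₗ[ℝ] M} (h : ∀ p, f (tensor p) = g (tensor p)) : f = g :=
  (basisMonomials ι ℝ).ext fun α => by
    rw [coe_basisMonomials]
    simp only
    rw [monomial_eq_tensor, h]

/-- A tensor product of elements of spans lies in every subspace that contains the tensor products
of the generators. -/
theorem tensor_mem {G : ι → Set (Polynomial ℝ)} {S : Submodule ℝ (MvPolynomial ι ℝ)}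
    (hG : ∀ g : ι → Polynomial ℝ, (∀ i, g i ∈ G i) → tensor g ∈ S) {p : ι → Polynomial ℝ}
    (hp : ∀ i, p i ∈ Submodule.span ℝ (G i)) : tensor p ∈ S := by
  classical
  -- Induction on the set of indices whose factor is only known to lie in the span; all others are
  -- already generators.
  suffices H : ∀ t : Finset ι, ∀ q : ι → Polynomial ℝ, (∀ i ∈ t, q i ∈ Submodule.span ℝ (G i)) →
      (∀ i ∉ t, q i ∈ G i) → tensor q ∈ S from
    H Finset.univ p (fun i _ => hp i) fun i hi => absurd (Finset.mem_univ i) hi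
  intro t
  induction t using Finset.induction_on with
  | empty => exact fun q _ hq => hG q fun i => hq i (Finset.notMem_empty i)
  | insert i t hi ih =>
    intro q hq hq'
    suffices ∀ y ∈ Submodule.span ℝ (G i), tensor (Function.update q i y) ∈ S by
      simpa using this (q i) (hq i (Finset.mem_insert_self i t))
    intro y hy
    induction hy using Submodule.span_induction with
    | mem y hy =>
      refine ih _ (fun j hj => ?_) fun j hj => ?_
      · have hji : j ≠ i := fun h => hi (h ▸ hj)
        rw [Function.update_of_ne hji]
        exact hq j (Finset.mem_insert_of_mem hj)
      · rcases eq_or_ne j i with rfl | hji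
        · rwa [Function.update_self]
        · rw [Function.update_of_ne hji]
          exact hq' j (by simp [hji, hj])
    | zero => simp [tensor_update]
    | add x y _ _ hx hy =>
      rw [tensor_update] at hx hy ⊢
      rw [map_add, add_mul]
      exact S.add_mem hx hy
    | smul c x _ hx =>
      rw [tensor_update] at hx ⊢
      rw [map_smul, smul_mul_assoc]
      exact S.smul_mem c hx

theorem tensor_mem_restrictSupport {N : ι → ℕ} {p : ι → Polynomial ℝ}
    (hp : ∀ i, p i ∈ Polynomial.degreeLT ℝ (N i)) :
    tensor p ∈ restrictSupport ℝ {α : ι →₀ ℕ | ∀ i, α i < N i} := by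
  classical
  refine tensor_mem (G := fun i => ↑(Finset.image (fun m => (Polynomial.X ^ m : Polynomial ℝ))
    (Finset.range (N i)))) (fun g hg => ?_) fun i => ?_
  · have : ∀ i, ∃ m < N i, Polynomial.X ^ m = g i := fun i => by simpa using hg i
    choose m hm hg' using this
    have h := monomial_eq_tensor (Finsupp.equivFunOnFinite.symm m)
    simp only [Finsupp.equivFunOnFinite_symm_apply_apply, hg'] at h
    rw [show tensor g = _ from h.symm, monomial_mem_restrictSupport]
    exact Or.inl fun i => by simpa using hm i
  · rw [← Polynomial.degreeLT_eq_span_X_pow]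
    exact hp i

/-- The integral of a polynomial over `[-1, 1]^ι`. -/
def cubeInt : MvPolynomial ι ℝ →ₗ[ℝ] ℝ where
  toFun q := ∫ x in Set.Icc (-1 : ι → ℝ) 1, eval x q
  map_add' p q := by
    simp only [map_add]
    exact MeasureTheory.integral_add
      ((MvPolynomial.continuous_eval p).continuousOn.integrableOn_compact isCompact_Icc)
      ((MvPolynomial.continuous_eval q).continuousOn.integrableOn_compact isCompact_Icc)
  map_smul' c p := by
    simp only [smul_eval, RingHom.id_apply]
    exact MeasureTheory.integral_const_mul c _

theorem eval_tensor (x : ι → ℝ) (p : ι → Polynomial ℝ) :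
    eval x (tensor p) = ∏ i, (p i).eval (x i) := by
  rw [tensor, map_prod]
  refine Finset.prod_congr rfl fun i _ => ?_
  have := Polynomial.aeval_algHom_apply (aeval x : MvPolynomial ι ℝ →ₐ[ℝ] ℝ) (X i) (p i)
  rw [aeval_X] at this
  rw [← coe_aeval_eq_eval]
  exact this.symm

theorem cubeInt_tensor (p : ι → Polynomial ℝ) : cubeInt (tensor p) = ∏ i, polyIntegral (p i) := by
  change ∫ x in Set.Icc (-1 : ι → ℝ) 1, eval x (tensor p) = _
  simp only [eval_tensor]
  rw [← Set.pi_univ_Icc, MeasureTheory.volume_pi, MeasureTheory.Measure.restrict_pi_pi]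
  exact MeasureTheory.integral_fintype_prod_eq_prod (fun i (y : ℝ) => (p i).eval y)

end Tensor

/-! ### Coefficients of `Q_r^-` and wedge products with monomial forms -/

section Forms

variable {ι : Type} [Fintype ι] [LinearOrder ι]

omit [Fintype ι] in
-- Strict bounds match `degreeLT` and equal the numbers of degrees of freedom per variable; `1 ≤ r`
-- makes `≤ r - 1` the same as `< r`.
theorem coefficientSpace_eq {r : ℕ} (hr : 1 ≤ r) (σ : Finset ι) : coefficientSpace r σ =
    restrictSupport ℝ {α : ι →₀ ℕ | ∀ i, α i < if i ∈ σ then r else r + 1} := by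
  rw [coefficientSpace]
  congr 1
  ext α
  simp only [Set.mem_ofPred_eq]
  refine ⟨fun h i => ?_, fun h => ⟨fun i hi => ?_, fun i hi => ?_⟩⟩
  · split_ifs with hi
    · have := h.2 i hi; omega
    · have := h.1 i hi; omega
  · have := h i; rw [if_neg hi] at this; omega
  · have := h i; rw [if_pos hi] at this; omega

/-- Exponents at most `r` but different from `r` are at most `r - 1`. Thus `Q_r^-` imposes
independent conditions on the coefficients, which allows work on one `σ` at a time. -/
theorem mem_Qminus {r k : ℕ} (hr : 1 ≤ r) {u : PForm ι} : u ∈ Qminus ι r k ↔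
    ∀ σ, (σ.card = k → u σ ∈ coefficientSpace r σ) ∧ (σ.card ≠ k → u σ = 0) := by
  constructor
  · intro hu
    induction hu using Submodule.span_induction with
    | mem m hm =>
      obtain ⟨α, σ, hσ, hα, hc, rfl⟩ := hm
      intro τ
      rcases eq_or_ne τ σ with rfl | hne
      · refine ⟨fun _ => ?_, fun h => absurd hσ h⟩
        rw [formMonomial, Pi.single_eq_same, coefficientSpace, monomial_mem_restrictSupport]
        refine Or.inl ⟨fun i _ => hα i, fun j hj => ?_⟩
        rw [cdeg, Finset.card_eq_zero] at hc
        have h1 := Finset.filter_eq_empty_iff.1 hc hj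
        have h2 := hα j
        omega
      · rw [formMonomial, Pi.single_eq_of_ne hne]
        exact ⟨fun _ => Submodule.zero_mem _, fun _ => rfl⟩
    | zero => exact fun σ => ⟨fun _ => Submodule.zero_mem _, fun _ => rfl⟩
    | add u v _ _ hu hv =>
      exact fun σ => ⟨fun h => Submodule.add_mem _ ((hu σ).1 h) ((hv σ).1 h),
        fun h => by rw [Pi.add_apply, (hu σ).2 h, (hv σ).2 h, add_zero]⟩
    | smul c u _ hu =>
      exact fun σ => ⟨fun h => Submodule.smul_mem _ _ ((hu σ).1 h),
        fun h => by rw [Pi.smul_apply, (hu σ).2 h, smul_zero]⟩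
  · intro h
    rw [← Finset.univ_sum_single u]
    refine Submodule.sum_mem _ fun σ _ => ?_
    by_cases hσ : σ.card = k
    · suffices coefficientSpace r σ ≤ (Qminus ι r k).comap
          (LinearMap.single ℝ (fun _ : Finset ι => MvPolynomial ι ℝ) σ) from this ((h σ).1 hσ)
      rw [coefficientSpace, restrictSupport_eq_span, Submodule.span_le]
      rintro _ ⟨α, ⟨h1, h2⟩, rfl⟩
      refine Submodule.subset_span ⟨α, σ, hσ, fun i => ?_, ?_, rfl⟩
      · by_cases hi : i ∈ σ
        · exact (h2 i hi).trans (Nat.sub_le r 1)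
        · exact h1 i hi
      · rw [cdeg, Finset.card_eq_zero, Finset.filter_eq_empty_iff]
        intro i hi
        have := h2 i hi
        omega
    · rw [(h σ).2 hσ, Pi.single_zero]
      exact Submodule.zero_mem _

theorem wedge_formMonomial (u : PForm ι) (β : ι →₀ ℕ) (τ : Finset ι) :
    wedge u (formMonomial β τ) Finset.univ = wedgeSign τᶜ τ • (u τᶜ * monomial β 1) := by
  rw [wedge, Finset.sum_eq_single τᶜ]
  · rw [← Finset.compl_eq_univ_sdiff, compl_compl, formMonomial, Pi.single_eq_same]
  · intro σ _ hσ
    rw [← Finset.compl_eq_univ_sdiff, formMonomial, Pi.single_eq_of_ne, mul_zero, smul_zero]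
    rintro rfl
    exact hσ (compl_compl σ).symm
  · simp

omit [Fintype ι] in
theorem wedge_add (u v w : PForm ι) : wedge u (v + w) = wedge u v + wedge u w := by
  funext ρ
  simp [wedge, mul_add, Finset.sum_add_distrib]

omit [Fintype ι] in
theorem wedge_smul (c : ℝ) (u v : PForm ι) : wedge u (c • v) = c • wedge u v := by
  funext ρ
  simp only [wedge, Pi.smul_apply, mul_smul_comm, Finset.smul_sum]
  exact Finset.sum_congr rfl fun σ _ => smul_comm _ _ _

omit [LinearOrder ι] in
theorem cubeIntegral_eq (w : PForm ι) : cubeIntegral w = cubeInt (w Finset.univ) := rfl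

omit [Fintype ι] in
theorem wedgeSign_ne_zero (σ τ : Finset ι) : wedgeSign σ τ ≠ 0 :=
  pow_ne_zero _ (by norm_num)

end Forms

/-! ### Face moments and the tensor product projection -/

section Faces

variable {n : ℕ}

/-- The restriction of a polynomial to a face, in the free variables. -/
def restrictFace (s : Fin n → SignType) :
    MvPolynomial (Fin n) ℝ →ₐ[ℝ] MvPolynomial (Free s) ℝ :=
  aeval fun i : Fin n =>
    if h : s i = 0 then (X (⟨i, h⟩ : Free s) : MvPolynomial (Free s) ℝ)
    else C ((s i : SignType) : ℝ)

theorem trace_apply (s : Fin n → SignType) (u : PForm (Fin n)) (τ : Finset (Free s)) :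
    trace s u τ =
      restrictFace s (u (τ.map (Function.Embedding.subtype fun i : Fin n => s i = 0))) := rfl

theorem restrictFace_tensor (s : Fin n → SignType) (p : Fin n → Polynomial ℝ) :
    restrictFace s (tensor p) =
      (∏ i : {i // ¬ s i = 0}, (p i).eval ((s i : SignType) : ℝ)) •
        tensor fun i : Free s => p i := by
  rw [tensor, map_prod, ← Fintype.prod_subtype_mul_prod_subtype (fun i => s i = 0), mul_comm,
    smul_eq_C_mul, map_prod, tensor]
  congr 1
  · refine Finset.prod_congr rfl fun i _ => ?_
    rw [← Polynomial.aeval_algHom_apply, restrictFace, aeval_X, dif_neg i.2]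
    exact Polynomial.aeval_algebraMap_apply_eq_algebraMap_eval _ _
  · refine Finset.prod_congr rfl fun i _ => ?_
    rw [← Polynomial.aeval_algHom_apply, restrictFace, aeval_X, dif_pos i.2]

/-- The moment of a polynomial over the face `s` against `∏ i, x_i ^ b_i`, over the free `i`. -/
def faceMoment (s : Fin n → SignType) (b : Fin n → ℕ) : MvPolynomial (Fin n) ℝ →ₗ[ℝ] ℝ :=
  cubeInt ∘ₗ LinearMap.mulRight ℝ (tensor fun i : Free s => Polynomial.X ^ b i) ∘ₗ
    (restrictFace s).toLinearMap

/-- Fubini on the free variables, evaluation on the fixed ones: the label `s i` of the face is also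
the label of the one-variable functional. -/
theorem faceMoment_tensor (s : Fin n → SignType) (b : Fin n → ℕ) (p : Fin n → Polynomial ℝ) :
    faceMoment s b (tensor p) = ∏ i, dof (s i, b i) (p i) := by
  change cubeInt (restrictFace s (tensor p) * _) = _
  rw [restrictFace_tensor, smul_mul_assoc, map_smul, tensor_mul, cubeInt_tensor,
    ← Fintype.prod_subtype_mul_prod_subtype (fun i => s i = 0), smul_eq_mul]
  refine (mul_comm _ _).trans (congrArg₂ _ ?_ ?_)
  · refine Finset.prod_congr rfl fun i _ => ?_
    rw [i.2, dof_zero]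
    rfl
  · refine Finset.prod_congr rfl fun i _ => ?_
    rw [dof_of_ne i.2]

/-- The degrees of freedom in the variable `x_i` of the coefficient of `dx_σ`. -/
def dofs (r : ℕ) (σ : Finset (Fin n)) (i : Fin n) : Finset (SignType × ℕ) :=
  if i ∈ σ then innerDofs r else outerDofs r

theorem card_dofs {r : ℕ} (hr : 1 ≤ r) (σ : Finset (Fin n)) (i : Fin n) :
    (dofs r σ i).card = if i ∈ σ then r else r + 1 := by
  unfold dofs
  split_ifs
  · exact card_innerDofs r
  · exact card_outerDofs hr

theorem isDualFamily_dofs {r : ℕ} (hr : 1 ≤ r) (σ : Finset (Fin n)) (i : Fin n) :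
    IsDualFamily (dofs r σ i) (dualFamily (dofs r σ i)) := by
  unfold dofs
  split_ifs
  · exact (unisolvent_innerDofs r).isDualFamily
  · exact (unisolvent_outerDofs hr).isDualFamily

/-- The projection of the coefficient of `dx_σ`. -/
def project (r : ℕ) (σ : Finset (Fin n)) : MvPolynomial (Fin n) ℝ →ₗ[ℝ] MvPolynomial (Fin n) ℝ :=
  ∑ a ∈ Fintype.piFinset (dofs r σ),
    (faceMoment (fun i => (a i).1) fun i => (a i).2).smulRight
      (tensor fun i => dualFamily (dofs r σ i) (a i))

theorem project_apply (r : ℕ) (σ : Finset (Fin n)) (q : MvPolynomial (Fin n) ℝ) :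
    project r σ q = ∑ a ∈ Fintype.piFinset (dofs r σ),
      faceMoment (fun i => (a i).1) (fun i => (a i).2) q •
        tensor fun i => dualFamily (dofs r σ i) (a i) := by
  simp [project]

/-- Expanding a product of sums over the variables yields the sum over all choices of one functional
per variable. -/
theorem project_tensor (r : ℕ) (σ : Finset (Fin n)) (p : Fin n → Polynomial ℝ) :
    project r σ (tensor p) = tensor fun i => interp (dofs r σ i) (p i) := by
  rw [project_apply]
  simp only [tensor, interp, map_sum, map_smul]
  rw [Finset.prod_univ_sum]
  refine Finset.sum_congr rfl fun a _ => ?_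
  rw [← tensor, faceMoment_tensor, Finset.prod_smul]

theorem project_mem {r : ℕ} (hr : 1 ≤ r) (σ : Finset (Fin n)) (q : MvPolynomial (Fin n) ℝ) :
    project r σ q ∈ coefficientSpace r σ := by
  rw [project_apply, coefficientSpace_eq hr]
  refine Submodule.sum_mem _ fun a ha => Submodule.smul_mem _ _ (tensor_mem_restrictSupport ?_)
  intro i
  rw [← card_dofs hr]
  exact (isDualFamily_dofs hr σ i).1 _ (Fintype.mem_piFinset.1 ha i)

theorem project_eq_self {r : ℕ} (hr : 1 ≤ r) {σ : Finset (Fin n)} {q : MvPolynomial (Fin n) ℝ}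
    (hq : q ∈ coefficientSpace r σ) : project r σ q = q := by
  rw [coefficientSpace_eq hr, restrictSupport_eq_span] at hq
  induction hq using Submodule.span_induction with
  | mem m hm =>
    obtain ⟨α, hα, rfl⟩ := hm
    simp only
    rw [monomial_eq_tensor, project_tensor]
    congr 1
    funext i
    refine (isDualFamily_dofs hr σ i).2.2 _ ?_
    rw [Polynomial.mem_degreeLT, card_dofs hr, Polynomial.degree_X_pow]
    exact_mod_cast hα i
  | zero => exact map_zero _
  | add x y _ _ hx hy => rw [map_add, hx, hy]
  | smul c x _ hx => rw [map_smul, hx]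

theorem faceMoment_project {r : ℕ} (hr : 1 ≤ r) (σ : Finset (Fin n)) {a : Fin n → SignType × ℕ}
    (ha : a ∈ Fintype.piFinset (dofs r σ)) (q : MvPolynomial (Fin n) ℝ) :
    faceMoment (fun i => (a i).1) (fun i => (a i).2) (project r σ q) =
      faceMoment (fun i => (a i).1) (fun i => (a i).2) q := by
  suffices H : faceMoment (fun i => (a i).1) (fun i => (a i).2) ∘ₗ project r σ =
      faceMoment (fun i => (a i).1) fun i => (a i).2 from LinearMap.congr_fun H q
  refine linearMap_ext_tensor fun p => ?_
  rw [LinearMap.comp_apply, project_tensor, faceMoment_tensor, faceMoment_tensor]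
  refine Finset.prod_congr rfl fun i _ => ?_
  have hai := Fintype.mem_piFinset.1 ha i
  rw [interp, map_sum, Finset.sum_congr rfl fun b hb => by
    rw [map_smul, (isDualFamily_dofs hr σ i).2.1 b hb _ hai]]
  simp [hai]

/-- The values of `b` on fixed coordinates are arbitrary, since only free ones enter the test
monomial. -/
theorem cubeIntegral_wedge_trace (s : Fin n → SignType) (u : PForm (Fin n)) (β : Free s →₀ ℕ)
    (b : Fin n → ℕ) (hb : ∀ i : Free s, b i = β i) (τ : Finset (Free s)) :
    cubeIntegral (wedge (trace s u) (formMonomial β τ)) = wedgeSign τᶜ τ *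
      faceMoment s b (u (τᶜ.map (Function.Embedding.subtype fun i : Fin n => s i = 0))) := by
  rw [cubeIntegral_eq, wedge_formMonomial, map_smul, smul_eq_mul, trace_apply, monomial_eq_tensor]
  simp only [← hb]
  rfl

/-- Choosing one functional per variable amounts to choosing a face (the first components) and a
test monomial on it (the second components). -/
theorem sameMoments_iff {r k : ℕ} (hr : 1 ≤ r) {u w : PForm (Fin n)} : SameMoments r k u w ↔
    ∀ σ : Finset (Fin n), σ.card = k → ∀ a ∈ Fintype.piFinset (dofs r σ),
      faceMoment (fun i => (a i).1) (fun i => (a i).2) (u σ) =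
        faceMoment (fun i => (a i).1) (fun i => (a i).2) (w σ) := by
  constructor
  · rintro h σ rfl a ha
    rw [Fintype.mem_piFinset] at ha
    have hin : ∀ i ∈ σ, (a i).1 = 0 ∧ (a i).2 < r := fun i hi => by
      have := ha i
      rwa [dofs, if_pos hi, mem_innerDofs] at this
    have hout : ∀ i ∉ σ, (a i).1 = 0 → (a i).2 < r - 1 := fun i hi h0 => by
      have := ha i
      rw [dofs, if_neg hi, mem_outerDofs] at this
      tauto
    let s : Fin n → SignType := fun i => (a i).1
    -- The directions in `σ` are all free, so the test form must carry the remaining free ones.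
    let τ : Finset (Free s) := Finset.univ.filter fun i => i.1 ∉ σ
    have hτ : τᶜ.map (Function.Embedding.subtype fun i : Fin n => s i = 0) = σ := by
      ext i
      simp only [τ, Finset.mem_map, Finset.mem_compl, Finset.mem_filter, Finset.mem_univ, true_and,
        not_not, Function.Embedding.subtype_apply, Subtype.exists, exists_and_left,
        exists_prop, exists_eq_right_right]
      exact ⟨fun h => h.1, fun h => ⟨h, (hin i h).1⟩⟩
    have hcard : τᶜ.card = σ.card := by rw [← hτ, Finset.card_map]
    have hle : σ.card ≤ faceDim s := hcard ▸ Finset.card_le_univ _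
    have hτc : τ.card = faceDim s - σ.card := by
      rw [← hcard, ← Finset.card_compl, compl_compl]
    let β : Free s →₀ ℕ := Finsupp.equivFunOnFinite.symm fun i => (a i).2
    have hβ : ∀ i : Free s, (a i).2 = β i := fun i => by simp [β]
    have hv : formMonomial β τ ∈ Qminus (Free s) (r - 1) (faceDim s - σ.card) := by
      refine Submodule.subset_span ⟨β, τ, hτc, fun i => ?_, ?_, rfl⟩
      · rw [← hβ i]
        by_cases hi : i.1 ∈ σ
        · have := (hin i hi).2; omega
        · exact (hout i hi i.2).le
      · rw [cdeg, Finset.card_eq_zero, Finset.filter_eq_empty_iff]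
        intro i hi
        rw [← hβ i]
        exact (hout i (Finset.mem_filter.1 hi).2 i.2).ne
    have key := h s hle _ hv
    rw [cubeIntegral_wedge_trace s u β (fun i => (a i).2) hβ, cubeIntegral_wedge_trace s w β (fun i => (a i).2) hβ, hτ] at key
    exact mul_left_cancel₀ (wedgeSign_ne_zero _ _) key
  · intro h s hk v hv
    induction hv using Submodule.span_induction with
    | mem m hm =>
      obtain ⟨β, τ, hτ, hβ, hc, rfl⟩ := hm
      -- At a fixed coordinate, `0` is the index that `outerDofs` pairs with an endpoint value.
      let b : Fin n → ℕ := fun i => if hi : s i = 0 then β ⟨i, hi⟩ else 0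
      have hb : ∀ i : Free s, b i = β i := fun i => dif_pos i.2
      rw [cubeIntegral_wedge_trace s u β b hb, cubeIntegral_wedge_trace s w β b hb]
      congr 1
      refine h _ ?_ (fun i => (s i, b i)) (Fintype.mem_piFinset.2 fun i => ?_)
      · rw [Finset.card_map, Finset.card_compl, hτ]
        exact Nat.sub_sub_self hk
      · have hmem : i ∈ τᶜ.map (Function.Embedding.subtype fun i : Fin n => s i = 0) ↔
            ∃ h : s i = 0, (⟨i, h⟩ : Free s) ∉ τ := by simp
        rw [dofs]
        split_ifs with hi
        · obtain ⟨h0, -⟩ := hmem.1 hi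
          rw [mem_innerDofs]
          have := hβ ⟨i, h0⟩
          exact ⟨h0, by simp only [b, dif_pos h0]; omega⟩
        · rw [mem_outerDofs]
          by_cases h0 : s i = 0
          · have hi' : (⟨i, h0⟩ : Free s) ∈ τ := by
              by_contra hn
              exact hi (hmem.2 ⟨h0, hn⟩)
            -- Conforming degree zero sharpens `β ≤ r - 1` to `β < r - 1` in the directions of `τ`.
            rw [cdeg, Finset.card_eq_zero] at hc
            have h1 := Finset.filter_eq_empty_iff.1 hc hi'
            have h2 := hβ ⟨i, h0⟩
            exact Or.inl ⟨h0, by simp only [b, dif_pos h0]; omega⟩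
          · exact Or.inr ⟨h0, dif_neg h0⟩
    | zero =>
      have : ∀ u' : PForm (Free s), wedge u' 0 = 0 := fun u' => by
        simpa using wedge_smul 0 u' 0
      rw [this, this]
    | add x y _ _ hx hy =>
      rw [wedge_add, wedge_add, cubeIntegral_eq, cubeIntegral_eq, Pi.add_apply, Pi.add_apply,
        map_add, map_add, ← cubeIntegral_eq, ← cubeIntegral_eq, hx, hy]
      rfl
    | smul c x _ hx =>
      rw [wedge_smul, wedge_smul, cubeIntegral_eq, cubeIntegral_eq, Pi.smul_apply, Pi.smul_apply,
        map_smul, map_smul, ← cubeIntegral_eq, ← cubeIntegral_eq, hx]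

end Faces


/-! ### Legendre form of the error -/

theorem Unisolvent.interp_mem {A : Finset (SignType × ℕ)} (h : Unisolvent A) (p : Polynomial ℝ) :
    interp A p ∈ Polynomial.degreeLT ℝ A.card :=
  Submodule.sum_mem _ fun a ha => Submodule.smul_mem _ _ (h.isDualFamily.1 a ha)

theorem interp_innerDofs_mem (r : ℕ) (p : Polynomial ℝ) :
    interp (innerDofs r) p ∈ Polynomial.degreeLT ℝ r := by
  simpa only [card_innerDofs] using (unisolvent_innerDofs r).interp_mem p

theorem X_pow_mem_degreeLT {m N : ℕ} (h : m < N) :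
    (Polynomial.X ^ m : Polynomial ℝ) ∈ Polynomial.degreeLT ℝ N := by
  rw [Polynomial.mem_degreeLT, Polynomial.degree_X_pow]
  exact_mod_cast h

section Conforming

variable {ι : Type} [Fintype ι] [LinearOrder ι]

/-- All factors other than the `j`-th are expanded in the Legendre basis, leaving `L_r(x_j)`
untouched. -/
theorem tensor_mem_conformingLegendreSpan {r : ℕ} {σ : Finset ι} {j : ι} (hj : j ∈ σ)
    {p : ι → Polynomial ℝ} (hp : p j ∈ Submodule.span ℝ {legendre r}) :
    tensor p ∈ conformingLegendreSpan r σ := by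
  refine tensor_mem (G := Function.update (fun _ => Set.range legendre) j {legendre r})
    (fun g hg => ?_) fun i => ?_
  · have hj' : g j = legendre r := by simpa using hg j
    have : ∀ i, ∃ d, legendre d = g i := fun i => by
      rcases eq_or_ne i j with rfl | hij
      · exact ⟨r, hj'.symm⟩
      · simpa [hij] using hg i
    choose d hd using this
    -- The chosen `d j` is only known to give the polynomial `L_r`, so the index is reset to `r`.
    refine Submodule.subset_span ⟨Function.update d j r, ⟨j, hj, Function.update_self ..⟩,
      Finset.prod_congr rfl fun i _ => ?_⟩
    rw [legendreAt]
    rcases eq_or_ne i j with rfl | hij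
    · rw [Function.update_self, hj']
    · rw [Function.update_of_ne hij, hd]
  · rcases eq_or_ne i j with rfl | hij
    · simpa using hp
    · rw [Function.update_of_ne hij, span_range_legendre]
      trivial

/-- Truncating the Legendre expansions of the factors with index in `t ⊆ σ` changes a tensor product
by an element of the conforming Legendre span. -/
theorem tensor_sub_tensor_interp_mem {r : ℕ} {σ : Finset ι} {p : ι → Polynomial ℝ}
    (hp : ∀ j ∈ σ, p j ∈ Polynomial.degreeLT ℝ (r + 1)) (t : Finset ι) (ht : t ⊆ σ) :
    tensor p - tensor (fun i => if i ∈ t then interp (innerDofs r) (p i) else p i) ∈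
      conformingLegendreSpan r σ := by
  induction t using Finset.induction_on with
  | empty => simp
  | insert j t hj ih =>
    obtain ⟨hjσ, htσ⟩ := Finset.insert_subset_iff.1 ht
    -- Telescoping: the two new tensor products differ in the factor `j` only, by a multiple of
    -- `L_r`.
    rw [← sub_add_sub_cancel _ (tensor fun i => if i ∈ t then interp (innerDofs r) (p i) else p i)]
    refine Submodule.add_mem _ (ih htσ) ?_
    rw [tensor_sub j fun i hij => by simp [hij]]
    refine tensor_mem_conformingLegendreSpan hjσ ?_
    obtain ⟨c, hc⟩ := exists_sub_interp_innerDofs (hp j hjσ)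
    simp only [Function.update_self, if_neg hj, Finset.mem_insert_self, if_true, hc]
    exact Submodule.smul_mem _ _ (Submodule.mem_span_singleton_self _)

/-- The coefficients of `dx_σ` of the form
`∑_{i ∉ σ} (L_{r+1}(x_i) - L_{r-1}(x_i)) p_i + v₀`. -/
def errorSpace (r : ℕ) (σ : Finset ι) : Submodule ℝ (MvPolynomial ι ℝ) where
  carrier := {f | ∃ (p : ι → MvPolynomial ι ℝ) (v₀ : MvPolynomial ι ℝ),
    (∀ i ∈ σᶜ, p i ∈ coefficientSpace r σ) ∧ v₀ ∈ conformingLegendreSpan r σ ∧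
    f = ∑ i ∈ σᶜ, (legendreAt (r + 1) i - legendreAt (r - 1) i) * p i + v₀}
  zero_mem' := ⟨0, 0, fun _ _ => Submodule.zero_mem _, Submodule.zero_mem _, by simp⟩
  add_mem' := by
    rintro _ _ ⟨p, v, hp, hv, rfl⟩ ⟨q, w, hq, hw, rfl⟩
    refine ⟨p + q, v + w, fun i hi => Submodule.add_mem _ (hp i hi) (hq i hi),
      Submodule.add_mem _ hv hw, ?_⟩
    simp only [Pi.add_apply, mul_add, Finset.sum_add_distrib]
    ring
  smul_mem' := by
    rintro c _ ⟨p, v, hp, hv, rfl⟩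
    refine ⟨c • p, c • v, fun i hi => Submodule.smul_mem _ _ (hp i hi),
      Submodule.smul_mem _ _ hv, ?_⟩
    simp only [Pi.smul_apply, mul_smul_comm, smul_add, Finset.smul_sum]

theorem conformingLegendreSpan_le_errorSpace (r : ℕ) (σ : Finset ι) :
    conformingLegendreSpan r σ ≤ errorSpace r σ := fun v hv =>
  ⟨0, v, fun _ _ => Submodule.zero_mem _, hv, by simp⟩

theorem mul_mem_errorSpace {r : ℕ} {σ : Finset ι} {i : ι} (hi : i ∉ σ) {p : MvPolynomial ι ℝ}
    (hp : p ∈ coefficientSpace r σ) :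
    (legendreAt (r + 1) i - legendreAt (r - 1) i) * p ∈ errorSpace r σ := by
  refine ⟨Pi.single i p, 0, fun j _ => ?_, Submodule.zero_mem _, ?_⟩
  · rcases eq_or_ne j i with rfl | hj
    · rwa [Pi.single_eq_same]
    · rw [Pi.single_eq_of_ne hj]
      exact Submodule.zero_mem _
  · rw [add_zero, Finset.sum_eq_single i]
    · rw [Pi.single_eq_same]
    · intro j _ hj
      rw [Pi.single_eq_of_ne hj, mul_zero]
    · intro h
      exact absurd (Finset.mem_compl.2 hi) h

end Conforming

/-! ### Projection errors of the coefficients of `Q̃_r` -/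

variable {n : ℕ}

/-- The polynomials whose projection error has the asserted form. -/
def goodSpace (r : ℕ) (σ : Finset (Fin n)) : Submodule ℝ (MvPolynomial (Fin n) ℝ) :=
  (errorSpace r σ).comap (LinearMap.id - project r σ)

theorem mem_goodSpace {r : ℕ} {σ : Finset (Fin n)} {f : MvPolynomial (Fin n) ℝ} :
    f ∈ goodSpace r σ ↔ f - project r σ f ∈ errorSpace r σ := Iff.rfl

/-- The outer projections reproduce degree `≤ r`, so only the truncations in `σ` contribute. -/
theorem tensor_mem_goodSpace {r : ℕ} (hr : 1 ≤ r) {σ : Finset (Fin n)}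
    {p : Fin n → Polynomial ℝ} (hp : ∀ j, p j ∈ Polynomial.degreeLT ℝ (r + 1)) :
    tensor p ∈ goodSpace r σ := by
  rw [mem_goodSpace, project_tensor]
  have h := tensor_sub_tensor_interp_mem (fun j _ => hp j) σ subset_rfl
  refine conformingLegendreSpan_le_errorSpace r σ ?_
  convert h using 3
  funext i
  rw [dofs]
  split_ifs
  · rfl
  · exact interp_outerDofs_eq_self hr (hp i)

/-- The variables in `σ` are truncated before `x_i` is projected, so that the cofactor of `L_{r+1} -
L_{r-1}` has degree `≤ r - 1` in them. -/
theorem tensor_mem_goodSpace_of_notMem {r : ℕ} (hr : 1 ≤ r) {σ : Finset (Fin n)} {i : Fin n}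
    (hi : i ∉ σ) {p : Fin n → Polynomial ℝ} (hpi : p i ∈ Polynomial.degreeLT ℝ (r + 2))
    (hp : ∀ j ≠ i, p j ∈ Polynomial.degreeLT ℝ (r + 1)) : tensor p ∈ goodSpace r σ := by
  rw [mem_goodSpace, project_tensor]
  let q : Fin n → Polynomial ℝ := fun j => if j ∈ σ then interp (innerDofs r) (p j) else p j
  rw [← sub_add_sub_cancel _ (tensor q)]
  refine Submodule.add_mem _ (conformingLegendreSpan_le_errorSpace r σ
    (tensor_sub_tensor_interp_mem (fun j hj => hp j fun h => hi (h ▸ hj)) σ subset_rfl)) ?_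
  rw [tensor_sub i fun j hj => ?_]
  · obtain ⟨c, hc⟩ := exists_sub_interp_outerDofs hr hpi
    -- Putting `1` in position `i` turns the product of the other factors into a tensor product; up
    -- to a scalar it is the `p_{σ,i}` sought.
    have hone := tensor_update q i 1
    rw [map_one, one_mul] at hone
    have hq : tensor (Function.update q i 1) ∈ coefficientSpace r σ := by
      rw [coefficientSpace_eq hr]
      refine tensor_mem_restrictSupport fun j => ?_
      rcases eq_or_ne j i with rfl | hj
      · rw [Function.update_self, if_neg hi, ← pow_zero Polynomial.X]
        exact X_pow_mem_degreeLT (Nat.succ_pos r)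
      · rw [Function.update_of_ne hj]
        simp only [q]
        split_ifs
        · exact interp_innerDofs_mem r _
        · exact hp j hj
    simp only [q, dofs, if_neg hi, hc]
    rw [tensor_update, ← hone, map_smul, smul_mul_assoc, map_sub]
    exact Submodule.smul_mem _ c (mul_mem_errorSpace hi hq)
  · simp only [q, dofs]
    split_ifs
    · rfl
    · exact (interp_outerDofs_eq_self hr (hp j hj)).symm

/-- Subtraction of exponents is truncated, which is harmless: the upper bounds on the degrees
persist, and `c` is arbitrary. -/
theorem monomial_mem_goodSpace {r : ℕ} (hr : 1 ≤ r) {σ : Finset (Fin n)} {α : Fin n →₀ ℕ}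
    (hα : ∀ i, α i ≤ r) {i j : Fin n} (hij : i = j ∨ i ∉ σ) (c : ℝ) :
    monomial (Finsupp.single i 1 + α - Finsupp.single j 1) c ∈ goodSpace r σ := by
  rw [← mul_one c, ← smul_eq_mul, ← smul_monomial]
  refine Submodule.smul_mem _ _ ?_
  rw [monomial_eq_tensor]
  rcases hij with rfl | hi
  · rw [add_tsub_cancel_left]
    exact tensor_mem_goodSpace hr fun l => X_pow_mem_degreeLT (Nat.lt_succ_of_le (hα l))
  · refine tensor_mem_goodSpace_of_notMem hr hi (X_pow_mem_degreeLT ?_)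
      fun l hl => X_pow_mem_degreeLT ?_
    · have := hα i
      simp only [Finsupp.tsub_apply, Finsupp.add_apply, Finsupp.single_eq_same]
      omega
    · have := hα l
      simp only [Finsupp.tsub_apply, Finsupp.add_apply, Finsupp.single_eq_of_ne hl]
      omega

/-- To reach `dx_σ`, `d` differentiates in some `x_j` with `j ∈ σ`, and `κ` has multiplied by some
`x_i` with `i ∉ σ - j`. Either `i = j` and the exponents return to `α`, or `i ∉ σ`; no degree rises
inside `σ`. -/
theorem extD_koszul_formMonomial_mem {r : ℕ} (hr : 1 ≤ r) {α : Fin n →₀ ℕ} (hα : ∀ i, α i ≤ r)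
    (τ σ : Finset (Fin n)) : extD (koszul (formMonomial α τ)) σ ∈ goodSpace r σ := by
  refine Submodule.sum_mem _ fun j hj => Submodule.smul_mem _ _ ?_
  change pderiv j (∑ i ∈ (σ.erase j)ᶜ, _) ∈ _
  rw [map_sum]
  refine Submodule.sum_mem _ fun i hi => ?_
  rw [Derivation.map_smul]
  refine Submodule.smul_mem _ _ ?_
  rw [formMonomial, Pi.single_apply]
  split_ifs
  · rw [X, monomial_mul, mul_one, pderiv_monomial]
    refine monomial_mem_goodSpace hr hα ?_ _
    rw [Finset.mem_compl, Finset.mem_erase] at hi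
    tauto
  · rw [mul_zero, map_zero]
    exact Submodule.zero_mem _

theorem mem_goodSpace_of_mem_Qtilde {r k : ℕ} (hr : 1 ≤ r) {u : PForm (Fin n)}
    (hu : u ∈ Qtilde (Fin n) r k) {σ : Finset (Fin n)} (hσ : σ.card = k) :
    u σ ∈ goodSpace r σ := by
  suffices Qtilde (Fin n) r k ≤ (goodSpace r σ).comap
      (LinearMap.proj σ : PForm (Fin n) →ₗ[ℝ] MvPolynomial (Fin n) ℝ) from this hu
  refine sup_le (fun w hw => ?_) (Submodule.map_le_iff_le_comap.2 (Submodule.span_le.2 ?_))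
  · rw [Submodule.mem_comap, LinearMap.proj_apply, mem_goodSpace,
      project_eq_self hr (((mem_Qminus hr).1 hw σ).1 hσ), sub_self]
    exact Submodule.zero_mem _
  · rintro _ ⟨α, τ, -, hα, -, rfl⟩
    exact extD_koszul_formMonomial_mem hr hα τ σ

/-! ### The projection of forms and the theorem -/

/-- The projection of a polynomial form to `Q_r^- Λ^k`, coefficient by coefficient. -/
def formProject (r k : ℕ) : PForm (Fin n) →ₗ[ℝ] PForm (Fin n) :=
  LinearMap.pi fun σ => if σ.card = k then project r σ ∘ₗ LinearMap.proj σ else 0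

theorem formProject_apply {r k : ℕ} {σ : Finset (Fin n)} (hσ : σ.card = k) (u : PForm (Fin n)) :
    formProject r k u σ = project r σ (u σ) := by
  simp [formProject, hσ]

theorem formProject_apply_of_ne {r k : ℕ} {σ : Finset (Fin n)} (hσ : σ.card ≠ k)
    (u : PForm (Fin n)) : formProject r k u σ = 0 := by
  simp [formProject, hσ]

theorem formProject_mem {r : ℕ} (hr : 1 ≤ r) (k : ℕ) (u : PForm (Fin n)) :
    formProject r k u ∈ Qminus (Fin n) r k :=
  (mem_Qminus hr).2 fun σ =>
    ⟨fun hσ => by rw [formProject_apply hσ]; exact project_mem hr σ _,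
      fun hσ => formProject_apply_of_ne hσ u⟩

/-- The projection depends on the moments alone, preserves them, and fixes `Q_r^-`; this gives
existence and uniqueness together. -/
theorem sameMoments_iff_eq_formProject {r k : ℕ} (hr : 1 ≤ r) {u w : PForm (Fin n)}
    (hw : w ∈ Qminus (Fin n) r k) : SameMoments r k u w ↔ w = formProject r k u := by
  rw [sameMoments_iff hr]
  constructor
  · intro h
    funext σ
    by_cases hσ : σ.card = k
    · rw [formProject_apply hσ, ← project_eq_self hr (((mem_Qminus hr).1 hw σ).1 hσ),
        project_apply, project_apply]
      exact Finset.sum_congr rfl fun a ha => by rw [h σ hσ a ha]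
    · rw [formProject_apply_of_ne hσ, ((mem_Qminus hr).1 hw σ).2 hσ]
  · rintro rfl σ hσ a ha
    rw [formProject_apply hσ, faceMoment_project hr σ ha]

end CubicalForms

end

theorem mainTheorem8 (n k r : ℕ) (hk : k ≤ n) (hr : 1 ≤ r) :
    ∃ P : CubicalForms.Qtilde (Fin n) r k →ₗ[ℝ] CubicalForms.Qminus (Fin n) r k,
      (∀ (u : CubicalForms.Qtilde (Fin n) r k) (w : CubicalForms.Qminus (Fin n) r k),
        CubicalForms.SameMoments r k (u : CubicalForms.PForm (Fin n)) w ↔ w = P u) ∧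
      ∀ (u : CubicalForms.Qtilde (Fin n) r k) (σ : Finset (Fin n)), σ.card = k →
        ∃ (p : Fin n → MvPolynomial (Fin n) ℝ) (v₀ : MvPolynomial (Fin n) ℝ),
          (∀ i ∈ σᶜ, p i ∈ CubicalForms.coefficientSpace r σ) ∧
          v₀ ∈ CubicalForms.conformingLegendreSpan r σ ∧
          ((u : CubicalForms.PForm (Fin n)) - (P u : CubicalForms.PForm (Fin n))) σ =
            ∑ i ∈ σᶜ, (CubicalForms.legendreAt (r + 1) i - CubicalForms.legendreAt (r - 1) i) * p i
              + v₀ := by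
  refine ⟨((CubicalForms.formProject r k).codRestrict _ (CubicalForms.formProject_mem hr k)).comp
    (CubicalForms.Qtilde (Fin n) r k).subtype, fun u w => ?_, fun u σ hσ => ?_⟩
  · rw [CubicalForms.sameMoments_iff_eq_formProject hr w.2, Subtype.ext_iff]
    rfl
  · have h := CubicalForms.mem_goodSpace.1 (CubicalForms.mem_goodSpace_of_mem_Qtilde hr u.2 hσ)
    rw [← CubicalForms.formProject_apply hσ] at h
    exact h
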